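/- Let $d, k \ge 0$ be integers, let $h_1, \dots, h_n \colon \mathbb{R}^d \to \mathbb{R}$ be a finite collection of affine functions (repetitions allowed), and assume $n > k$. Let $L_k \colon \mathbb{R}^d \to \mathbb{R}$ be the $k$-level of the collection, that is, the function for which $\xi = L_k(x)$ is the unique real number with $$\#\{i : h_i(x) > \xi\} \le k < \#\{i : h_i(x) > \xi\} + \#\{i : h_i(x) = \xi\};$$ in words, $L_k(x)$ is the $(k+1)$-largest of the values $h_1(x), \dots, h_n(x)$, counted with multiplicity. Call $x \in \mathbb{R}^d$ a local minimum of $L_k$ if $x$ has an open neighborhood $U$ such that $L_k(x) < L_k(y)$ for every $y \in U$ with $y \ne x$. Then $L_k$ has at most $\binom{d+k}{d}$ local minima. -/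

import Mathlib

noncomputable section

/-- The number of graphs of the affine functions `h i` that pass above the point
`(x, ξ)` of `ℝ^d × ℝ`, that is, for which `ξ - h i x` is negative. -/
def numAbove {d : ℕ} {ι : Type*} [Fintype ι] (h : ι → (EuclideanSpace ℝ (Fin d) →ᵃ[ℝ] ℝ))
    (x : EuclideanSpace ℝ (Fin d)) (ξ : ℝ) : ℕ :=
  (Finset.univ.filter (fun i => ξ - h i x < 0)).card

/-- The number of graphs of the affine functions `h i` that pass through the point
`(x, ξ)` of `ℝ^d × ℝ`, that is, for which `ξ - h i x` is zero. -/
def numThrough {d : ℕ} {ι : Type*} [Fintype ι] (h : ι → (EuclideanSpace ℝ (Fin d) →ᵃ[ℝ] ℝ))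
    (x : EuclideanSpace ℝ (Fin d)) (ξ : ℝ) : ℕ :=
  (Finset.univ.filter (fun i => ξ - h i x = 0)).card

/-- `L` is the `k`-level of the finite collection `h` of affine functions, counted with
multiplicity: `L x` is the `(k + 1)`-largest among the values `h i x`. -/
def IsLevel {d : ℕ} {ι : Type*} [Fintype ι] (h : ι → (EuclideanSpace ℝ (Fin d) →ᵃ[ℝ] ℝ))
    (k : ℕ) (L : EuclideanSpace ℝ (Fin d) → ℝ) : Prop :=
  ∀ x, numAbove h x (L x) ≤ k ∧ k < numAbove h x (L x) + numThrough h x (L x)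

/-- Local minima are strict: `L x < L y` for all `y ≠ x` in an open neighborhood of `x`. -/
def IsLevelLocalMin {d : ℕ} (L : EuclideanSpace ℝ (Fin d) → ℝ)
    (x : EuclideanSpace ℝ (Fin d)) : Prop :=
  ∃ U : Set (EuclideanSpace ℝ (Fin d)), IsOpen U ∧ x ∈ U ∧ ∀ y ∈ U, y ≠ x → L x < L y

/-- The `k`-level exists and is unique as soon as the collection has more than `k` members. -/
theorem existsUnique_isLevel {d : ℕ} {ι : Type*} [Fintype ι]
    (h : ι → (EuclideanSpace ℝ (Fin d) →ᵃ[ℝ] ℝ)) (k : ℕ) (hk : k < Fintype.card ι) :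
    ∃! L, IsLevel h k L := by
  classical
  have add_eq : ∀ x ξ, numAbove h x ξ + numThrough h x ξ
      = (Finset.univ.filter (fun i => ξ ≤ h i x)).card := by
    intro x ξ
    unfold numAbove numThrough
    rw [← Finset.card_union_of_disjoint]
    · congr 1
      ext i
      simp only [Finset.mem_union, Finset.mem_filter, Finset.mem_univ, true_and]
      rw [sub_neg, sub_eq_zero, le_iff_lt_or_eq]
    · rw [Finset.disjoint_filter]
      intro i _ h1 h2
      linarith
  have mono : ∀ x ξ ξ', ξ < ξ' → numAbove h x ξ' + numThrough h x ξ' ≤ numAbove h x ξ := by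
    intro x ξ ξ' hlt
    rw [add_eq]
    apply Finset.card_le_card
    intro i
    simp only [Finset.mem_filter, Finset.mem_univ, true_and]
    intro hi
    linarith
  have ex : ∀ x, ∃ ξ, numAbove h x ξ ≤ k ∧ k < numAbove h x ξ + numThrough h x ξ := by
    intro x
    have hne : Nonempty ι := Fintype.card_pos_iff.1 (by omega)
    obtain ⟨m, -, hm⟩ := Finset.exists_max_image Finset.univ (fun i => h i x)
      Finset.univ_nonempty
    obtain ⟨i, hi, hmin⟩ := Finset.exists_min_image
      (Finset.univ.filter (fun i => numAbove h x (h i x) ≤ k)) (fun i => h i x) ⟨m, by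
        have : numAbove h x (h m x) = 0 := by
          unfold numAbove
          rw [Finset.card_eq_zero, Finset.filter_eq_empty_iff]
          intro j hj
          have := hm j hj
          simpa using this
        simp [this]⟩
    simp only [Finset.mem_filter, Finset.mem_univ, true_and] at hi hmin
    refine ⟨h i x, hi, ?_⟩
    rw [add_eq]
    by_cases hall : ∀ j, h i x ≤ h j x
    · rw [Finset.filter_true_of_mem (fun j _ => hall j)]
      simpa using hk
    · push Not at hall
      obtain ⟨j0, hj0⟩ := hall
      obtain ⟨j, hj, hmax⟩ := Finset.exists_max_image
        (Finset.univ.filter (fun j => h j x < h i x)) (fun j => h j x) ⟨j0, by simpa using hj0⟩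
      simp only [Finset.mem_filter, Finset.mem_univ, true_and] at hj hmax
      have hjk : k < numAbove h x (h j x) := by
        by_contra hcon
        have := hmin j (by omega)
        linarith
      refine lt_of_lt_of_le hjk (Finset.card_le_card ?_)
      intro l
      simp only [Finset.mem_filter, Finset.mem_univ, true_and]
      intro hl
      by_contra hcon
      have := hmax l (by linarith)
      linarith
  choose L hL using ex
  refine ⟨L, hL, fun L' hL' => funext fun x => ?_⟩
  rcases lt_trichotomy (L' x) (L x) with hlt | heq | hlt
  · have := mono x _ _ hlt
    have := hL x
    have := hL' x
    omega
  · exact heq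
  · have := mono x _ _ hlt
    have := hL x
    have := hL' x
    omega

end

open Finset Filter Topology

/-! Suppose first that the graphs are in general position and that the upper envelope stays coercive
after any `k` functions are removed. Call `d + 1` graphs a basis if they meet in the unique lowest
point of their upper envelope, and call the graphs strictly above that point its violators. Each
large enough subcollection has exactly one basis without violators inside it, namely the one at the
minimum of its envelope (`exists_isVertexBasis_of_coercive`, `IsVertexBasis.eq_of_forall_le`).
Double counting (`card_bases_with_violators`) then forces the number of bases with exactly `k`
violators to be the binomial coefficient. A local minimum of the `k`-level is the vertex of such a
basis (`isVertexBasis_of_local_min`), and distinct minima give distinct bases.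

The general case is reduced to this one in `card_strict_local_min_le`. Steep functions that are low
near the given minima are adjoined to make the envelopes coercive, and a small perturbation gives
general position. Strictness of the minima ensures that each one leaves a nearby, possibly
non-strict, local minimum. -/

/-! ### Counting bases by their number of violators. -/

/-- If every sufficiently large set `R` contains exactly one basis without violators in `R`, then
the number of bases in `R` having exactly `j` violators in `R` is a binomial coefficient. -/
theorem card_bases_with_violators {ι : Type*} [Fintype ι] [DecidableEq ι] {d m : ℕ}
    (B : Finset (Finset ι)) (V : Finset ι → Finset ι) (hcard : ∀ S ∈ B, S.card = d + 1)
    (hdisj : ∀ S ∈ B, Disjoint S (V S))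
    (h0 : ∀ R : Finset ι, m ≤ R.card → ∃! S, S ∈ B ∧ S ⊆ R ∧ Disjoint (V S) R) (j : ℕ) :
    ∀ R : Finset ι, m + j ≤ R.card →
      (B.filter (fun S => S ⊆ R ∧ (V S ∩ R).card = j)).card = (d + j).choose d := by
  induction j with
  | zero =>
    intro R hR
    obtain ⟨S, hS, huniq⟩ := h0 R (by omega)
    rw [Nat.add_zero, Nat.choose_self, card_eq_one]
    refine ⟨S, ?_⟩
    ext T
    simp only [mem_filter, mem_singleton, card_eq_zero, ← disjoint_iff_inter_eq_empty]
    exact ⟨fun h => huniq T h, fun h => h ▸ hS⟩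
  | succ j ih =>
    intro R hR
    set g : ℕ → ℕ := fun j => (B.filter (fun S => S ⊆ R ∧ (V S ∩ R).card = j)).card with hg
    -- Count pairs `(h, S)` where `S` has `j` violators once `h` is removed from `R`. A basis with
    -- `j` violators in `R` allows every `h` outside itself and its violators, that is `R.card - (d
    -- + 1) - j` choices; one with `j + 1` violators allows exactly these `j + 1`. The subtracted
    -- term is kept on the left to stay in `ℕ`.
    have key : ∑ h ∈ R, (B.filter (fun S => S ⊆ R.erase h ∧ (V S ∩ R.erase h).card = j)).card
        + (d + 1 + j) * g j = R.card * g j + (j + 1) * g (j + 1) := by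
      have e1 : ∑ h ∈ R, (B.filter (fun S => S ⊆ R.erase h ∧ (V S ∩ R.erase h).card = j)).card
          = ∑ S ∈ B, (R.filter (fun h => S ⊆ R.erase h ∧ (V S ∩ R.erase h).card = j)).card := by
        simp only [card_filter]
        exact sum_comm
      rw [e1, hg]
      simp only [card_filter _ B, mul_sum]
      rw [← sum_add_distrib, ← sum_add_distrib]
      refine sum_congr rfl fun S hS => ?_
      by_cases hSR : S ⊆ R
      · have hd := hdisj S hS
        have hfil : R.filter (fun h => S ⊆ R.erase h ∧ (V S ∩ R.erase h).card = j)
            = (R \ S).filter (fun h => if h ∈ V S then (V S ∩ R).card = j + 1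
                else (V S ∩ R).card = j) := by
          ext h
          simp only [mem_filter, Finset.mem_sdiff, subset_erase, inter_erase]
          constructor
          · rintro ⟨hR, ⟨-, hS⟩, hc⟩
            refine ⟨⟨hR, hS⟩, ?_⟩
            split_ifs with hV
            · rw [card_erase_of_mem (by simp [hV, hR])] at hc
              have : 0 < (V S ∩ R).card := card_pos.2 ⟨h, by simp [hV, hR]⟩
              omega
            · rwa [erase_eq_of_notMem (by simp [hV])] at hc
          · rintro ⟨⟨hR, hS⟩, hc⟩
            refine ⟨hR, ⟨hSR, hS⟩, ?_⟩
            split_ifs at hc with hV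
            · rw [card_erase_of_mem (by simp [hV, hR]), hc]; rfl
            · rwa [erase_eq_of_notMem (by simp [hV])]
        have hVR : (V S ∩ R) ⊆ R \ S := by
          intro h hh
          rw [mem_inter] at hh
          exact Finset.mem_sdiff.2 ⟨hh.2, fun hs => disjoint_left.1 hd hs hh.1⟩
        have hRS : (R \ S).card + (d + 1) = R.card := by
          rw [← hcard S hS]; exact card_sdiff_add_card_eq_card hSR
        rw [hfil]
        by_cases h1 : (V S ∩ R).card = j
        · have : (R \ S).filter (fun h => if h ∈ V S then (V S ∩ R).card = j + 1
                else (V S ∩ R).card = j) = (R \ S) \ (V S ∩ R) := by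
            ext h
            simp only [mem_filter, Finset.mem_sdiff, mem_inter, h1]
            by_cases hV : h ∈ V S <;> simp [hV]
            tauto
          rw [this]
          have := card_sdiff_add_card_eq_card hVR
          simp [hSR, h1]
          omega
        · by_cases h2 : (V S ∩ R).card = j + 1
          · have : (R \ S).filter (fun h => if h ∈ V S then (V S ∩ R).card = j + 1
                else (V S ∩ R).card = j) = V S ∩ R := by
              ext h
              have := @hVR h
              simp only [mem_filter, h2]
              simp only [Finset.mem_sdiff, mem_inter] at this ⊢
              by_cases hV : h ∈ V S <;> simp [hV]
              tauto
            rw [this]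
            simp [hSR, h2]
          · simp [h1, h2]
      · have : R.filter (fun h => S ⊆ R.erase h ∧ (V S ∩ R.erase h).card = j) = ∅ := by
          rw [filter_eq_empty_iff]
          intro h _ hh
          exact hSR (hh.1.trans (erase_subset _ _))
        simp [hSR, this]
    have hsum : ∑ h ∈ R, (B.filter (fun S => S ⊆ R.erase h ∧ (V S ∩ R.erase h).card = j)).card
        = R.card * (d + j).choose d := by
      rw [sum_congr rfl (fun h hh => ih (R.erase h) (by rw [card_erase_of_mem hh]; omega)),
        sum_const, smul_eq_mul]
    have hgj : g j = (d + j).choose d := ih R (by omega)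
    rw [hsum, hgj] at key
    have hch : (d + 1 + j) * (d + j).choose d = (j + 1) * (d + (j + 1)).choose d := by
      have := Nat.add_one_mul_choose_eq (d + j) j
      rw [Nat.choose_symm_add, ← add_assoc, Nat.choose_symm_of_eq_add (n := d + j + 1) (a := d)
        (b := j + 1) (by omega)]
      rw [show d + 1 + j = d + j + 1 by omega]
      linarith
    have : (j + 1) * g (j + 1) = (j + 1) * (d + (j + 1)).choose d := by omega
    exact Nat.eq_of_mul_eq_mul_left (Nat.succ_pos j) this

/-! ### Perturbation to general position. -/

/-- The determinant is a polynomial in `t` whose coefficient in degree `Fintype.card n` is `A.det`,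
so it is not the zero polynomial. -/
theorem finite_setOf_det_smul_add_eq_zero {n : Type*} [Fintype n] [DecidableEq n]
    (A B : Matrix n n ℝ) (hA : A.det ≠ 0) : {t : ℝ | (t • A + B).det = 0}.Finite := by
  classical
  set p : Polynomial ℝ :=
    Matrix.det ((Polynomial.X : Polynomial ℝ) • A.map Polynomial.C + B.map Polynomial.C) with hp
  have hp0 : p ≠ 0 := by
    intro h
    apply hA
    rw [← Polynomial.coeff_det_X_add_C_card A B, ← hp, h, Polynomial.coeff_zero]
  have hev : ∀ t, (t • A + B).det = p.eval t := by
    intro t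
    rw [hp, ← Polynomial.coe_evalRingHom, RingHom.map_det]
    congr 1
    ext i j
    simp [mul_comm t]
  refine (p.roots.toFinset.finite_toSet).subset fun t ht => ?_
  simp only [Set.mem_ofPred_eq, hev] at ht
  simpa [hp0] using ht

/-- General position of the graphs of the affine functions `x ↦ a i ⬝ᵥ x + b i`. -/
structure IsGeneralPosition {d : ℕ} {ι : Type*} (a : ι → Fin d → ℝ) (b : ι → ℝ) : Prop where
  linearIndepOn : ∀ S : Finset ι, S.card ≤ d → LinearIndepOn ℝ a (S : Set ι)
  card_le : ∀ (S : Finset ι) (x : Fin d → ℝ) (ξ : ℝ), (∀ i ∈ S, a i ⬝ᵥ x + b i = ξ) →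
    S.card ≤ d + 1

theorem linearIndepOn_of_det_ne_zero {d : ℕ} {ι : Type*} (a : ι → Fin d → ℝ) (S : Finset ι)
    (f : Fin d → ι) (hf : ∀ i ∈ S, i ∈ Set.range f)
    (hdet : (Matrix.of fun i j => a (f i) j).det ≠ 0) : LinearIndepOn ℝ a (S : Set ι) := by
  have h : LinearIndependent ℝ (fun i => a (f i)) :=
    Matrix.linearIndependent_rows_of_det_ne_zero hdet
  have h2 : LinearIndepOn ℝ a (Set.range f) := by
    have hinj : Function.Injective f := fun i j hij => h.injective (by simp [hij])
    exact (linearIndepOn_range_iff hinj _).2 h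
  exact h2.mono fun i hi => hf i hi

theorem exists_fin_of_card_eq {ι : Type*} (S : Finset ι) {n : ℕ} (h : S.card = n) :
    ∃ f : Fin n → ι, Function.Injective f ∧ ∀ i, i ∈ S ↔ i ∈ Set.range f := by
  subst h
  refine ⟨fun i => (S.equivFin.symm i : ι), fun i j hij => ?_, fun i => ⟨fun hi => ?_, ?_⟩⟩
  · exact S.equivFin.symm.injective (Subtype.ext hij)
  · exact ⟨S.equivFin ⟨i, hi⟩, by simp⟩
  · rintro ⟨j, rfl⟩
    exact (S.equivFin.symm j).2

/-- Moving the coefficients along a moment curve brings affine functions into general position. -/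
theorem exists_isGeneralPosition {d : ℕ} {ι : Type*} [Fintype ι] (hd : d ≤ Fintype.card ι)
    (a : ι → Fin d → ℝ) (b : ι → ℝ) {ε : ℝ} (hε : 0 < ε) :
    ∃ (a' : ι → Fin d → ℝ) (b' : ι → ℝ), IsGeneralPosition a' b' ∧
      (∀ i j, |a' i j - a i j| ≤ ε) ∧ ∀ i, |b' i - b i| ≤ ε := by
  classical
  -- Nonzero parameters are needed because the `d × d` minors of `α` are Vandermonde determinants
  -- multiplied by the product of the `τ i`.
  obtain ⟨τ, hτ, hτ0⟩ : ∃ τ : ι → ℝ, Function.Injective τ ∧ ∀ i, τ i ≠ 0 := by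
    refine ⟨fun i => (Fintype.equivFin ι i : ℕ) + 1, fun i j hij => ?_, fun i => by positivity⟩
    simpa [Fin.val_inj] using hij
  set α : ι → Fin d → ℝ := fun i j => τ i ^ ((j : ℕ) + 1) with hα
  set β : ι → ℝ := fun i => τ i ^ (d + 1) with hβ
  -- Concurrency of `d + 2` graphs is a linear dependence among the columns of the rows `(1, a i, b
  -- i)`. For `α`, `β` these rows are full Vandermonde rows.
  set row : (ι → Fin d → ℝ) → (ι → ℝ) → ι → Fin (d + 2) → ℝ :=
    fun a b i => Fin.cons 1 (Fin.snoc (α := fun _ => ℝ) (a i) (b i)) with hrow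
  have hrowα : ∀ i j, row α β i j = τ i ^ (j : ℕ) := by
    intro i j
    refine Fin.cases (by simp [hrow]) (fun j => ?_) j
    refine Fin.lastCases ?_ (fun j => ?_) j
    · simp [hrow, hβ]
    · simp [hrow, hα]
  have fin1 : {t : ℝ | ∃ f : Fin d → ι, Function.Injective f ∧
      (t • (Matrix.of fun i j => α (f i) j) + Matrix.of fun i j => a (f i) j).det = 0}.Finite := by
    rw [Set.ofPred_exists]
    refine Set.finite_iUnion fun f => ?_
    by_cases hf : Function.Injective f
    · refine (finite_setOf_det_smul_add_eq_zero _ _ ?_).subset (fun t ht => ht.2)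
      have : (Matrix.of fun i j => α (f i) j)
          = Matrix.of fun i j => τ (f i) * Matrix.vandermonde (fun i => τ (f i)) i j := by
        ext i j
        simp [hα, Matrix.vandermonde, pow_succ']
      rw [this, Matrix.det_mul_column]
      exact mul_ne_zero (prod_ne_zero_iff.2 fun i _ => hτ0 _)
        (Matrix.det_vandermonde_ne_zero_iff.2 (hτ.comp hf))
    · simp [hf]
  have fin2 : {t : ℝ | ∃ f : Fin (d + 2) → ι, Function.Injective f ∧
      (t • (Matrix.of fun i j => row α β (f i) j) +
        Matrix.of fun i j => row a b (f i) j).det = 0}.Finite := by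
    rw [Set.ofPred_exists]
    refine Set.finite_iUnion fun f => ?_
    by_cases hf : Function.Injective f
    · refine (finite_setOf_det_smul_add_eq_zero _ _ ?_).subset (fun t ht => ht.2)
      have : (Matrix.of fun i j => row α β (f i) j)
          = Matrix.vandermonde (fun i => τ (f i)) := by
        ext i j
        simp [hrowα, Matrix.vandermonde]
      rw [this]
      exact Matrix.det_vandermonde_ne_zero_iff.2 (hτ.comp hf)
    · simp [hf]
  obtain ⟨K, hK0, hKα, hKβ⟩ : ∃ K : ℝ, 0 < K ∧ (∀ i j, |α i j| ≤ K) ∧ ∀ i, |β i| ≤ K := by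
    refine ⟨1 + ∑ i, (∑ j, |α i j| + |β i|), by positivity, fun i j => ?_, fun i => ?_⟩
    · have h1 : |α i j| ≤ ∑ j, |α i j| :=
        single_le_sum (f := fun j => |α i j|) (fun _ _ => abs_nonneg _) (mem_univ j)
      have h2 : ∑ j, |α i j| + |β i| ≤ ∑ i, (∑ j, |α i j| + |β i|) :=
        single_le_sum (f := fun i => ∑ j, |α i j| + |β i|) (fun _ _ => by positivity) (mem_univ i)
      have := abs_nonneg (β i)
      linarith
    · have h1 : 0 ≤ ∑ j, |α i j| := by positivity
      have h2 : ∑ j, |α i j| + |β i| ≤ ∑ i, (∑ j, |α i j| + |β i|) :=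
        single_le_sum (f := fun i => ∑ j, |α i j| + |β i|) (fun _ _ => by positivity) (mem_univ i)
      linarith
  obtain ⟨t, ⟨ht0, htε⟩, htfin⟩ :=
    ((Set.Ioo_infinite (show (0 : ℝ) < ε / K by positivity)).sdiff (fin1.union fin2)).nonempty
  simp only [Set.mem_union, Set.mem_ofPred_eq, not_or, not_exists, not_and] at htfin
  obtain ⟨ht1, ht2⟩ := htfin
  rw [lt_div_iff₀ hK0] at htε
  have hsmall : ∀ u : ℝ, |u| ≤ K → |t * u| ≤ ε := by
    intro u hu
    rw [abs_mul, abs_of_pos ht0]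
    nlinarith
  refine ⟨fun i j => a i j + t * α i j, fun i => b i + t * β i, ⟨?_, ?_⟩, fun i j => ?_,
    fun i => ?_⟩
  · intro S hS
    obtain ⟨T, hST, hT⟩ := exists_superset_card_eq hS hd
    obtain ⟨f, hf, hfT⟩ := exists_fin_of_card_eq T hT
    refine linearIndepOn_of_det_ne_zero _ S f (fun i hi => (hfT i).1 (hST hi)) ?_
    convert! ht1 f hf using 2
    ext i j
    simp [add_comm]
  · intro S x ξ hS
    by_contra hlt
    obtain ⟨T, hTS, hT⟩ := exists_subset_card_eq (show d + 2 ≤ S.card by omega)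
    obtain ⟨f, hf, hfT⟩ := exists_fin_of_card_eq T hT
    -- A common point `(x, ξ)` gives a kernel vector. Both matrices have first column `1`, so their
    -- combination has first column `t + 1`, whence the entry `-ξ / (t + 1)`.
    refine ht2 f hf (Matrix.exists_mulVec_eq_zero_iff.1
      ⟨Fin.cons (-ξ / (t + 1)) (Fin.snoc (α := fun _ => ℝ) x 1), fun h0 => ?_, ?_⟩)
    · have := congrFun h0 (Fin.last (d + 1))
      rw [← Fin.succ_last, Fin.cons_succ, Fin.snoc_last] at this
      simp at this
    · ext i
      have hi := hS (f i) (hTS ((hfT _).2 ⟨i, rfl⟩))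
      simp only [Matrix.mulVec, dotProduct, Matrix.add_apply, Matrix.smul_apply, Matrix.of_apply,
        Pi.zero_apply, smul_eq_mul] at hi ⊢
      rw [Fin.sum_univ_succ, Fin.sum_univ_castSucc]
      simp only [hrow, Fin.cons_zero, Fin.cons_succ, Fin.snoc_castSucc, Fin.snoc_last]
      have e : (t * 1 + 1) * (-ξ / (t + 1)) = -ξ := by field_simp
      rw [e, ← hi]
      simp only [add_comm (t * _)]
      ring
  · simpa using hsmall _ (hKα i j)
  · simpa using hsmall _ (hKβ i)

theorem IsGeneralPosition.bijective_dotProduct {d : ℕ} {ι : Type*} {a : ι → Fin d → ℝ} {b : ι → ℝ}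
    (h : IsGeneralPosition a b) {f : Fin d → ι} (hf : Function.Injective f) :
    Function.Bijective (fun y : Fin d → ℝ => fun i => a (f i) ⬝ᵥ y) := by
  classical
  have h1 : LinearIndepOn ℝ a (Set.range f) := by
    have := h.linearIndepOn (univ.image f) (card_image_le.trans (by simp))
    simpa using this
  have h2 : LinearIndependent ℝ (fun i => a (f i)) := (linearIndepOn_range_iff hf _).1 h1
  have hU : IsUnit (Matrix.of fun i j => a (f i) j) :=
    Matrix.linearIndependent_rows_iff_isUnit.1 h2
  exact ⟨Matrix.mulVec_injective_iff_isUnit.2 hU, Matrix.mulVec_surjective_iff_isUnit.2 hU⟩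

/-! ### Gordan's alternative and vertex bases. -/

/-- Gordan's alternative. -/
theorem exists_nonneg_relation_of_forall_exists_nonneg {d : ℕ} {ι : Type*} (a : ι → Fin d → ℝ)
    (A : Finset ι) (h : ∀ y : Fin d → ℝ, ∃ i ∈ A, 0 ≤ a i ⬝ᵥ y) :
    ∃ c : ι → ℝ, (∀ i ∈ A, 0 ≤ c i) ∧ ∑ i ∈ A, c i = 1 ∧ ∑ i ∈ A, c i • a i = 0 := by
  classical
  set Φ := Fintype.linearCombination ℝ (fun i : A => a i) with hΦ
  set K := Φ '' stdSimplex ℝ A with hK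
  have hconv : Convex ℝ K := (convex_stdSimplex ℝ A).linear_image Φ
  have hcomp : IsCompact K :=
    (isCompact_stdSimplex ℝ A).image (LinearMap.continuous_of_finiteDimensional Φ)
  -- `K` is the convex hull of the gradients. If it misses `0`, a separating functional gives a
  -- direction in which all of them are negative.
  by_cases h0 : (0 : Fin d → ℝ) ∈ K
  · obtain ⟨c, ⟨hc0, hc1⟩, hc⟩ := h0
    refine ⟨fun i => if hi : i ∈ A then c ⟨i, hi⟩ else 0, fun i hi => ?_, ?_, ?_⟩
    · simpa [hi] using hc0 ⟨i, hi⟩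
    · rw [← hc1, ← sum_coe_sort A]
      simp
    · rw [← hc, hΦ, Fintype.linearCombination_apply, ← sum_coe_sort A]
      simp
  · exfalso
    obtain ⟨g, u, hgu, hg⟩ := geometric_hahn_banach_point_closed hconv hcomp.isClosed h0
    have hgdot : ∀ v : Fin d → ℝ, g v = v ⬝ᵥ fun j => g (Pi.single j 1) := by
      intro v
      conv_lhs => rw [pi_eq_sum_univ' v]
      simp [dotProduct, map_sum]
    obtain ⟨i, hi, hneg⟩ := h (fun j => - g (Pi.single j 1))
    have hmem : a i ∈ K := by
      refine ⟨Pi.single ⟨i, hi⟩ 1, single_mem_stdSimplex ℝ _, ?_⟩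
      simp [hΦ]
    have h1 := hg _ hmem
    have h2 : a i ⬝ᵥ (fun j => - g (Pi.single j 1)) = - g (a i) := by
      rw [hgdot (a i), ← dotProduct_neg]; rfl
    rw [map_zero] at hgu
    linarith

/-- The graphs indexed by `S` meet at `(x, ξ)`, which is the unique lowest point of their upper
envelope, certified by a positive relation among the gradients. -/
structure IsVertexBasis {d : ℕ} {ι : Type*} (a : ι → Fin d → ℝ) (b : ι → ℝ) (S : Finset ι)
    (x : Fin d → ℝ) (ξ : ℝ) : Prop where
  card_eq : S.card = d + 1
  eq : ∀ i ∈ S, a i ⬝ᵥ x + b i = ξ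
  exists_relation : ∃ c : ι → ℝ, (∀ i ∈ S, 0 < c i) ∧ ∑ i ∈ S, c i • a i = 0

/-- Weighted by the positive relation, the gaps `ξ - (a i ⬝ᵥ y + b i)` sum to zero, since the sum
depends linearly on `x - y` through `∑ c i • a i`. So they cannot all be positive, and they vanish
if all are nonnegative. -/
theorem IsVertexBasis.le_and_eq {d : ℕ} {ι : Type*} {a : ι → Fin d → ℝ} {b : ι → ℝ} {S : Finset ι}
    {x : Fin d → ℝ} {ξ : ℝ} (h : IsVertexBasis a b S x ξ) {y : Fin d → ℝ} {η : ℝ}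
    (hy : ∀ i ∈ S, a i ⬝ᵥ y + b i ≤ η) :
    ξ ≤ η ∧ (η ≤ ξ → ∀ i ∈ S, a i ⬝ᵥ y + b i = ξ) := by
  obtain ⟨c, hc, hrel⟩ := h.exists_relation
  have hzero : ∀ z : Fin d → ℝ, ∑ i ∈ S, c i * (a i ⬝ᵥ z) = 0 := by
    intro z
    have : (∑ i ∈ S, c i • a i) ⬝ᵥ z = 0 := by rw [hrel, zero_dotProduct]
    rw [sum_dotProduct] at this
    simpa [smul_dotProduct] using this
  have hsum : ∑ i ∈ S, c i * (ξ - (a i ⬝ᵥ y + b i)) = 0 := by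
    have : ∀ i ∈ S, c i * (ξ - (a i ⬝ᵥ y + b i)) = c i * (a i ⬝ᵥ x) - c i * (a i ⬝ᵥ y) := by
      intro i hi
      rw [← h.eq i hi]; ring
    rw [sum_congr rfl this, sum_sub_distrib, hzero, hzero, sub_zero]
  have hne : S.Nonempty := card_pos.1 (by rw [h.card_eq]; omega)
  refine ⟨?_, fun hηξ i hi => ?_⟩
  · by_contra hlt
    push Not at hlt
    have : 0 < ∑ i ∈ S, c i * (ξ - (a i ⬝ᵥ y + b i)) :=
      sum_pos (fun i hi => mul_pos (hc i hi) (by linarith [hy i hi])) hne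
    linarith
  · have := (sum_eq_zero_iff_of_nonneg
      (fun i hi => mul_nonneg (hc i hi).le (by linarith [hy i hi]))).1 hsum i hi
    rcases mul_eq_zero.1 this with h1 | h1
    · exact absurd h1 (hc i hi).ne'
    · linarith

theorem IsVertexBasis.vertex_unique {d : ℕ} {ι : Type*} {a : ι → Fin d → ℝ} {b : ι → ℝ}
    (hgp : IsGeneralPosition a b) {S : Finset ι} {x x' : Fin d → ℝ} {ξ ξ' : ℝ}
    (h : IsVertexBasis a b S x ξ) (h' : IsVertexBasis a b S x' ξ') : x = x' ∧ ξ = ξ' := by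
  have hξ : ξ = ξ' := le_antisymm (h.le_and_eq fun i hi => (h'.eq i hi).le).1
    (h'.le_and_eq fun i hi => (h.eq i hi).le).1
  refine ⟨?_, hξ⟩
  obtain ⟨T, hTS, hT⟩ := exists_subset_card_eq (show d ≤ S.card by rw [h.card_eq]; omega)
  obtain ⟨f, hf, hfT⟩ := exists_fin_of_card_eq T hT
  refine (hgp.bijective_dotProduct hf).1 (funext fun i => ?_)
  have hi := hTS ((hfT _).2 ⟨i, rfl⟩)
  have h1 := h.eq _ hi
  have h2 := h'.eq _ hi
  simp only
  linarith

/-- This gives uniqueness of the basis without violators. The two heights agree, so all graphs of `S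
∪ S'` pass through `(x, ξ)`, and general position leaves room for only `d + 1` of them. -/
theorem IsVertexBasis.eq_of_forall_le {d : ℕ} {ι : Type*} {a : ι → Fin d → ℝ} {b : ι → ℝ}
    (hgp : IsGeneralPosition a b) {S S' : Finset ι} {x x' : Fin d → ℝ} {ξ ξ' : ℝ}
    (h : IsVertexBasis a b S x ξ) (h' : IsVertexBasis a b S' x' ξ')
    (hle : ∀ i ∈ S', a i ⬝ᵥ x + b i ≤ ξ) (hle' : ∀ i ∈ S, a i ⬝ᵥ x' + b i ≤ ξ') : S = S' := by
  classical
  have hξ : ξ = ξ' := le_antisymm (h.le_and_eq hle').1 (h'.le_and_eq hle).1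
  subst hξ
  have heq := (h'.le_and_eq hle).2 le_rfl
  have hcard := hgp.card_le (S ∪ S') x ξ fun i hi => by
    rcases mem_union.1 hi with hi | hi
    · exact h.eq i hi
    · exact heq i hi
  have e1 : S = S ∪ S' := eq_of_subset_of_card_le subset_union_left (by rw [h.card_eq]; exact hcard)
  have e2 : S' = S ∪ S' :=
    eq_of_subset_of_card_le subset_union_right (by rw [h'.card_eq]; exact hcard)
  rw [e1, ← e2]

/-! ### Local minima in general position. -/

/-- Moving from a point of the `k`-level at which it is locally minimal, in any direction. -/
theorem lt_card_above_add_card_nonneg {d : ℕ} {ι : Type*} {a : ι → Fin d → ℝ} {b : ι → ℝ}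
    {R : Finset ι} {x : Fin d → ℝ} {ξ : ℝ} {k : ℕ}
    (hnear : ∀ᶠ y in 𝓝 x, k < (R.filter (fun i => ξ ≤ a i ⬝ᵥ y + b i)).card) (z : Fin d → ℝ) :
    k < (R.filter (fun i => ξ < a i ⬝ᵥ x + b i)).card
      + ((R.filter (fun i => a i ⬝ᵥ x + b i = ξ)).filter (fun i => 0 ≤ a i ⬝ᵥ z)).card := by
  classical
  have hlim : Tendsto (fun t : ℝ => x + t • z) (𝓝[>] 0) (𝓝 x) := by
    have : Continuous (fun t : ℝ => x + t • z) := by fun_prop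
    have h2 := this.tendsto 0
    simp only [zero_smul, add_zero] at h2
    exact h2.mono_left nhdsWithin_le_nhds
  have hlow : ∀ᶠ y in 𝓝 x, ∀ i ∈ R, a i ⬝ᵥ x + b i < ξ → a i ⬝ᵥ y + b i < ξ := by
    rw [Filter.eventually_all_finset]
    intro i _
    by_cases hi : a i ⬝ᵥ x + b i < ξ
    · have hc : Continuous (fun y : Fin d → ℝ => a i ⬝ᵥ y + b i) := by fun_prop
      filter_upwards [hc.continuousAt.eventually_lt_const hi] with y hy _ using hy
    · exact Eventually.of_forall fun y h => absurd h hi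
  have hpos : ∀ᶠ t : ℝ in 𝓝[>] 0, 0 < t := self_mem_nhdsWithin
  -- After a short enough step along `z`, graphs below `ξ` remain below, and those at height `ξ` can
  -- count only if their slope along `z` is nonnegative.
  obtain ⟨t, h1, h2, ht⟩ := ((hlim.eventually hnear).and ((hlim.eventually hlow).and hpos)).exists
  refine h1.trans_le ((card_le_card ?_).trans (card_union_le _ _))
  intro i hi
  simp only [mem_union, mem_filter] at hi ⊢
  obtain ⟨hiR, hi⟩ := hi
  rcases lt_trichotomy (a i ⬝ᵥ x + b i) ξ with hlt | heq | hgt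
  · exact absurd (h2 i hiR hlt) (not_lt.2 hi)
  · refine Or.inr ⟨⟨hiR, heq⟩, ?_⟩
    rw [dotProduct_add, dotProduct_smul, smul_eq_mul] at hi
    by_contra hneg
    push Not at hneg
    nlinarith
  · exact Or.inl ⟨hiR, hgt⟩

/-- In general position, a local minimum of the `k`-level is the vertex of a basis with exactly
`k` violators. -/
theorem isVertexBasis_of_local_min {d : ℕ} {ι : Type*} {a : ι → Fin d → ℝ} {b : ι → ℝ}
    (hgp : IsGeneralPosition a b) {R : Finset ι} {x : Fin d → ℝ} {ξ : ℝ} {k : ℕ}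
    (habove : (R.filter (fun i => ξ < a i ⬝ᵥ x + b i)).card ≤ k)
    (hnear : ∀ᶠ y in 𝓝 x, k < (R.filter (fun i => ξ ≤ a i ⬝ᵥ y + b i)).card) :
    IsVertexBasis a b (R.filter (fun i => a i ⬝ᵥ x + b i = ξ)) x ξ ∧
      (R.filter (fun i => ξ < a i ⬝ᵥ x + b i)).card = k := by
  classical
  have hdir := lt_card_above_add_card_nonneg hnear
  set A := R.filter (fun i => a i ⬝ᵥ x + b i = ξ) with hA
  have hAeq : ∀ i ∈ A, a i ⬝ᵥ x + b i = ξ := fun i hi => (mem_filter.1 hi).2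
  have hAcard := hgp.card_le A x ξ hAeq
  obtain ⟨c, hc0, hc1, hc⟩ := exists_nonneg_relation_of_forall_exists_nonneg a A fun z => by
    have := hdir z
    obtain ⟨i, hi⟩ := card_pos.1 (show 0 < (A.filter (fun i => 0 ≤ a i ⬝ᵥ z)).card by omega)
    exact ⟨i, (mem_filter.1 hi).1, (mem_filter.1 hi).2⟩
  -- At most `d` gradients are independent, so a nontrivial relation must involve at least `d + 1`
  -- of them.
  have hsupp : d + 1 ≤ (A.filter (fun i => c i ≠ 0)).card := by
    by_contra hlt
    have hli := hgp.linearIndepOn (A.filter (fun i => c i ≠ 0)) (by omega)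
    have hzero : ∑ i ∈ A.filter (fun i => c i ≠ 0), c i • a i = 0 := by
      rw [← hc]
      refine sum_subset (filter_subset _ _) fun i hi hni => ?_
      have : c i = 0 := by simpa [hi] using hni
      rw [this, zero_smul]
    have hall := linearIndepOn_finset_iff.1 hli c hzero
    have : ∑ i ∈ A, c i = 0 := sum_eq_zero fun i hi => by
      by_contra hne
      exact hne (hall i (mem_filter.2 ⟨hi, hne⟩))
    linarith
  have hSA : A.filter (fun i => c i ≠ 0) = A :=
    eq_of_subset_of_card_le (filter_subset _ _) (hAcard.trans hsupp)
  have hcard : A.card = d + 1 := le_antisymm hAcard (by rwa [hSA] at hsupp)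
  refine ⟨⟨hcard, hAeq, c, fun i hi => ?_, hc⟩, ?_⟩
  · rw [← hSA] at hi
    obtain ⟨hi, hne⟩ := mem_filter.1 hi
    exact lt_of_le_of_ne (hc0 i hi) hne.symm
  · refine le_antisymm habove ?_
    obtain ⟨i₀, hi₀⟩ := card_pos.1 (show 0 < A.card by omega)
    obtain ⟨f, hf, hfT⟩ := exists_fin_of_card_eq (A.erase i₀)
      (show (A.erase i₀).card = d by rw [card_erase_of_mem hi₀, hcard]; rfl)
    -- Along this direction every graph of `A` except possibly that of `i₀` descends, so `hdir`
    -- leaves at least `k` graphs strictly above.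
    obtain ⟨z, hz⟩ := (hgp.bijective_dotProduct hf).2 (fun _ => -1)
    have hle : (A.filter (fun i => 0 ≤ a i ⬝ᵥ z)).card ≤ 1 := by
      refine (card_le_card fun i hi => ?_).trans (card_singleton i₀).le
      obtain ⟨hiA, hi⟩ := mem_filter.1 hi
      rw [mem_singleton]
      by_contra hne
      obtain ⟨j, rfl⟩ := (hfT i).1 (mem_erase.2 ⟨hne, hiA⟩)
      have := congrFun hz j
      simp only at this
      linarith
    have := hdir z
    omega

/-- The upper envelope is the `0`-level, and coercivity makes it attain its minimum. This supplies
the existence of a basis without violators. -/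
theorem exists_isVertexBasis_of_coercive {d : ℕ} {ι : Type*} {a : ι → Fin d → ℝ} {b : ι → ℝ}
    (hgp : IsGeneralPosition a b) {R : Finset ι} {c C : ℝ} (hc : 0 < c)
    (hR : ∀ y : Fin d → ℝ, ∃ i ∈ R, c * ‖y‖ - C ≤ a i ⬝ᵥ y + b i) :
    ∃ (S : Finset ι) (x : Fin d → ℝ) (ξ : ℝ), IsVertexBasis a b S x ξ ∧ S ⊆ R ∧
      ∀ i ∈ R, a i ⬝ᵥ x + b i ≤ ξ := by
  classical
  have hne : R.Nonempty := let ⟨i, hi, _⟩ := hR 0; ⟨i, hi⟩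
  set F : (Fin d → ℝ) → ℝ := fun y => R.sup' hne fun i => a i ⬝ᵥ y + b i with hF
  have hcont : Continuous F :=
    Continuous.finset_sup'_apply hne fun i _ => by fun_prop
  have hlim : Tendsto F (cocompact _) atTop := by
    have h1 : Tendsto (fun y : Fin d → ℝ => c * ‖y‖ - C) (cocompact _) atTop :=
      tendsto_atTop_add_const_right _ _ (tendsto_norm_cocompact_atTop.const_mul_atTop hc)
    refine tendsto_atTop_mono (fun y => ?_) h1
    obtain ⟨i, hi, h⟩ := hR y
    exact h.trans (le_sup' (fun i => a i ⬝ᵥ y + b i) hi)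
  obtain ⟨x, hx⟩ := hcont.exists_forall_le hlim
  have hle : ∀ i ∈ R, a i ⬝ᵥ x + b i ≤ F x := fun i hi => le_sup' (fun i => a i ⬝ᵥ x + b i) hi
  refine ⟨_, x, F x, (isVertexBasis_of_local_min (R := R) (k := 0) hgp ?_ ?_).1,
    filter_subset _ _, hle⟩
  · rw [Nat.le_zero, card_eq_zero, filter_eq_empty_iff]
    exact fun i hi => not_lt.2 (hle i hi)
  · refine Eventually.of_forall fun y => card_pos.2 ?_
    obtain ⟨i, hi, h⟩ := exists_mem_eq_sup' hne fun i => a i ⬝ᵥ y + b i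
    exact ⟨i, mem_filter.2 ⟨hi, h ▸ hx y⟩⟩

/-- The bound for local minima of the `k`-level in general position, when all collections obtained
by removing at most `k` functions have coercive upper envelopes. -/
theorem card_local_min_le_of_isGeneralPosition {d : ℕ} {ι : Type*} [Fintype ι]
    {a : ι → Fin d → ℝ} {b : ι → ℝ} (hgp : IsGeneralPosition a b) {m k : ℕ}
    (hmk : m + k ≤ Fintype.card ι) {c C : ℝ} (hc : 0 < c)
    (hR : ∀ R : Finset ι, m ≤ R.card → ∀ y : Fin d → ℝ, ∃ i ∈ R, c * ‖y‖ - C ≤ a i ⬝ᵥ y + b i)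
    (Q : Finset (Fin d → ℝ))
    (hQ : ∀ x ∈ Q, ∃ ξ : ℝ, (univ.filter (fun i => ξ < a i ⬝ᵥ x + b i)).card ≤ k ∧
      ∀ᶠ y in 𝓝 x, k < (univ.filter (fun i => ξ ≤ a i ⬝ᵥ y + b i)).card) :
    Q.card ≤ (d + k).choose d := by
  classical
  set B : Finset (Finset ι) := univ.filter fun S => ∃ x ξ, IsVertexBasis a b S x ξ with hB
  have hex : ∀ S : Finset ι, ∃ (x : Fin d → ℝ) (ξ : ℝ), S ∈ B → IsVertexBasis a b S x ξ := by
    intro S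
    by_cases hS : S ∈ B
    · obtain ⟨x, ξ, h⟩ := (mem_filter.1 hS).2
      exact ⟨x, ξ, fun _ => h⟩
    -- Outside `B` the vertex is a dummy value, never used.
    · exact ⟨0, 0, fun h => absurd h hS⟩
  choose X Ξ hX using hex
  have memB : ∀ {S x ξ}, IsVertexBasis a b S x ξ → S ∈ B := fun h =>
    mem_filter.2 ⟨mem_univ _, _, _, h⟩
  set V : Finset ι → Finset ι := fun S => univ.filter fun i => Ξ S < a i ⬝ᵥ X S + b i with hV
  have hcount := card_bases_with_violators (d := d) (m := m) B V (fun S hS => (hX S hS).card_eq)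
    (fun S hS => by
      rw [disjoint_left]
      intro i hi hiV
      exact (mem_filter.1 hiV).2.ne' ((hX S hS).eq i hi))
    (fun R hRm => by
      obtain ⟨S, x, ξ, hS, hSR, hle⟩ := exists_isVertexBasis_of_coercive hgp hc (hR R hRm)
      have hdisj : ∀ T, Disjoint (V T) R ↔ ∀ i ∈ R, a i ⬝ᵥ X T + b i ≤ Ξ T := by
        intro T
        rw [disjoint_right]
        simp [hV]
      obtain ⟨hx, hξ⟩ := (hX S (memB hS)).vertex_unique hgp hS
      refine ⟨S, ⟨memB hS, hSR, (hdisj S).2 (by rw [hx, hξ]; exact hle)⟩, ?_⟩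
      rintro T ⟨hT, hTR, hTV⟩
      exact (hX T hT).eq_of_forall_le hgp hS (fun i hi => (hdisj T).1 hTV i (hSR hi))
        (fun i hi => hle i (hTR hi))) k univ (by simpa using hmk)
  have hQ' : ∀ x : Fin d → ℝ, ∃ S : Finset ι, x ∈ Q → S ∈ B ∧ (V S).card = k ∧ X S = x := by
    intro x
    by_cases hx : x ∈ Q
    · obtain ⟨ξ, h1, h2⟩ := hQ x hx
      obtain ⟨h3, h4⟩ := isVertexBasis_of_local_min hgp h1 h2
      obtain ⟨h5, h6⟩ := (hX _ (memB h3)).vertex_unique hgp h3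
      exact ⟨_, fun _ => ⟨memB h3, by simp only [hV, h5, h6]; exact h4, h5⟩⟩
    · exact ⟨∅, fun h => absurd h hx⟩
  choose S hS using hQ'
  rw [← hcount]
  refine card_le_card_of_injOn S (fun x hx => ?_) fun x hx y hy hxy => ?_
  · obtain ⟨h1, h2, -⟩ := hS x hx
    simpa [h1] using h2
  · rw [← (hS x hx).2.2, ← (hS y hy).2.2, hxy]

/-! ### Order statistics and their stability. -/

/-- `ξ` is the `(k + 1)`-largest entry of `v`, counted with multiplicity. -/
def IsKthLargest {ι : Type*} [Fintype ι] (k : ℕ) (v : ι → ℝ) (ξ : ℝ) : Prop :=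
  (univ.filter (fun i => ξ < v i)).card ≤ k ∧ k < (univ.filter (fun i => ξ ≤ v i)).card

/-- This reduces comparisons of levels to comparisons of cardinalities. -/
theorem IsKthLargest.le_iff {ι : Type*} [Fintype ι] {k : ℕ} {v : ι → ℝ} {ξ : ℝ}
    (h : IsKthLargest k v ξ) (t : ℝ) : t ≤ ξ ↔ k < (univ.filter (fun i => t ≤ v i)).card := by
  constructor
  · intro ht
    exact h.2.trans_le (card_le_card (monotone_filter_right _ fun i _ hi => ht.trans hi))
  · intro ht
    by_contra hlt
    push Not at hlt
    have : (univ.filter (fun i => t ≤ v i)).card ≤ (univ.filter (fun i => ξ < v i)).card :=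
      card_le_card (monotone_filter_right _ fun i _ hi => hlt.trans_le hi)
    exact absurd h.1 (not_le.2 (ht.trans_le this))

theorem IsLevel.isKthLargest {d : ℕ} {ι : Type*} [Fintype ι]
    {h : ι → (EuclideanSpace ℝ (Fin d) →ᵃ[ℝ] ℝ)} {k : ℕ} {L : EuclideanSpace ℝ (Fin d) → ℝ}
    (hL : IsLevel h k L) (x : EuclideanSpace ℝ (Fin d)) :
    IsKthLargest k (fun i => h i x) (L x) := by
  classical
  obtain ⟨h1, h2⟩ := hL x
  unfold numAbove numThrough at *
  simp only [sub_neg] at h1 h2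
  refine ⟨h1, h2.trans_le ?_⟩
  rw [← card_union_of_disjoint]
  · refine card_le_card fun i hi => ?_
    simp only [mem_union, mem_filter, mem_univ, true_and, sub_eq_zero] at hi ⊢
    exact hi.elim le_of_lt le_of_eq
  · rw [disjoint_filter]
    intro i _ h1 h2
    linarith

theorem exists_isKthLargest {ι : Type*} [Fintype ι] {k : ℕ} (hk : k < Fintype.card ι)
    (v : ι → ℝ) : ∃ ξ, IsKthLargest k v ξ := by
  obtain ⟨L, hL, -⟩ := existsUnique_isLevel (d := 0) (fun i => AffineMap.const ℝ _ (v i)) k hk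
  exact ⟨L 0, hL.isKthLargest 0⟩

/-- Applied in both directions, this bounds the change of the level by the largest change of the
values; it yields both continuity of the level and its stability under perturbation. -/
theorem IsKthLargest.sub_le {ι : Type*} [Fintype ι] {k : ℕ} {v w : ι → ℝ} {ξ η ε : ℝ}
    (h : IsKthLargest k v ξ) (h' : IsKthLargest k w η) (hε : ∀ i, |v i - w i| ≤ ε) :
    ξ - ε ≤ η := by
  rw [h'.le_iff]
  refine h.2.trans_le (card_le_card (monotone_filter_right _ fun i _ hi => ?_))
  have := (abs_le.1 (hε i)).2
  linarith

theorem continuous_of_isKthLargest {X ι : Type*} [TopologicalSpace X] [Fintype ι] {k : ℕ}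
    {h : ι → X → ℝ} (hc : ∀ i, Continuous (h i)) {L : X → ℝ}
    (hL : ∀ x, IsKthLargest k (fun i => h i x) (L x)) : Continuous L := by
  refine continuous_iff_continuousAt.2 fun x => Metric.tendsto_nhds.2 fun ε hε => ?_
  have hev : ∀ᶠ y in 𝓝 x, ∀ i, dist (h i y) (h i x) < ε / 2 :=
    eventually_all.2 fun i => Metric.tendsto_nhds.1 ((hc i).tendsto x) _ (half_pos hε)
  filter_upwards [hev] with y hy
  have h1 := (hL y).sub_le (hL x) (ε := ε / 2) fun i => (hy i).le
  have h2 := (hL x).sub_le (hL y) (ε := ε / 2) fun i => by rw [abs_sub_comm]; exact (hy i).le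
  rw [Real.dist_eq, abs_lt]
  constructor <;> linarith

theorem abs_dotProduct_le_of_forall_abs_le {d : ℕ} {u y : Fin d → ℝ} {ε : ℝ}
    (hu : ∀ j, |u j| ≤ ε) : |u ⬝ᵥ y| ≤ d * ε * ‖y‖ := by
  have h : ∀ j ∈ (univ : Finset (Fin d)), |u j * y j| ≤ ε * ‖y‖ := by
    intro j _
    rw [abs_mul]
    exact mul_le_mul (hu j) (norm_le_pi_norm y j) (abs_nonneg _) ((abs_nonneg _).trans (hu j))
  refine (abs_sum_le_sum_abs _ _).trans ((sum_le_sum h).trans (le_of_eq ?_))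
  simp [mul_assoc]

/-! ### Coercive padding and reduction to general position. -/

/-- The signed coordinate vector `± e_j`. -/
def signedBasisVector {d : ℕ} (j : Fin d) (s : Bool) : Fin d → ℝ :=
  Pi.single j (if s then 1 else -1)

theorem signedBasisVector_dotProduct {d : ℕ} (j : Fin d) (s : Bool) (y : Fin d → ℝ) :
    signedBasisVector j s ⬝ᵥ y = if s then y j else - y j := by
  cases s <;> simp [signedBasisVector]

/-- If `k + 1` copies of perturbed vectors `± e_j` are present, coercivity survives the removal of
any `k` members. -/
theorem exists_mem_half_norm_le_dotProduct {d k : ℕ} {ι : Type*} [Fintype ι] (hk : k < Fintype.card ι)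
    (a : ι ⊕ (Fin (k + 1) × Fin d × Bool) → Fin d → ℝ) {ε : ℝ} (hε : d * ε ≤ 1 / 2)
    (ha : ∀ q j s l, |a (Sum.inr (q, j, s)) l - signedBasisVector j s l| ≤ ε)
    {R : Finset (ι ⊕ (Fin (k + 1) × Fin d × Bool))}
    (hR : Fintype.card (ι ⊕ (Fin (k + 1) × Fin d × Bool)) ≤ R.card + k) (y : Fin d → ℝ) :
    ∃ i ∈ R, 1 / 2 * ‖y‖ ≤ a i ⬝ᵥ y := by
  classical
  by_cases hy : y = 0
  · have : k < Fintype.card (ι ⊕ (Fin (k + 1) × Fin d × Bool)) := by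
      rw [Fintype.card_sum]; omega
    obtain ⟨i, hi⟩ := card_pos.1 (show 0 < R.card by omega)
    exact ⟨i, hi, by simp [hy]⟩
  · obtain ⟨j, hj⟩ : ∃ j, ‖y‖ ≤ |y j| := by
      by_contra hcon
      push Not at hcon
      exact lt_irrefl _ ((pi_norm_lt_iff (norm_pos_iff.2 hy)).2 hcon)
    obtain ⟨s, hs⟩ : ∃ s, signedBasisVector j s ⬝ᵥ y = |y j| := by
      rcases abs_choice (y j) with h | h
      · exact ⟨true, by rw [signedBasisVector_dotProduct, h]; rfl⟩
      · exact ⟨false, by rw [signedBasisVector_dotProduct, h]; rfl⟩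
    -- At most `k` members are missing, so one of the `k + 1` copies survives.
    obtain ⟨q, hq⟩ : ∃ q : Fin (k + 1), Sum.inr (q, j, s) ∈ R := by
      by_contra hcon
      push Not at hcon
      have h1 : (univ.image fun q : Fin (k + 1) =>
          (Sum.inr (q, j, s) : ι ⊕ (Fin (k + 1) × Fin d × Bool))) ⊆ Rᶜ := by
        intro i hi
        obtain ⟨q, -, rfl⟩ := mem_image.1 hi
        exact mem_compl.2 (hcon q)
      have h2 := card_le_card h1
      rw [card_image_of_injective _ (fun q q' h => by simpa using h), card_univ, Fintype.card_fin,
        card_compl] at h2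
      omega
    refine ⟨_, hq, ?_⟩
    have h1 := (abs_le.1 (abs_dotProduct_le_of_forall_abs_le (y := y)
      (u := a (Sum.inr (q, j, s)) - signedBasisVector j s) (ha q j s))).1
    rw [sub_dotProduct, hs] at h1
    have := norm_nonneg y
    nlinarith

theorem card_strict_local_min_le {d k : ℕ} {ι : Type*} [Fintype ι] (a : ι → Fin d → ℝ) (b : ι → ℝ)
    (L : (Fin d → ℝ) → ℝ) (hL : ∀ x, IsKthLargest k (fun i => a i ⬝ᵥ x + b i) (L x))
    (Q : Finset (Fin d → ℝ))
    (hQ : ∀ x ∈ Q, ∃ U : Set (Fin d → ℝ), IsOpen U ∧ x ∈ U ∧ ∀ y ∈ U, y ≠ x → L x < L y) :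
    Q.card ≤ (d + k).choose d := by
  classical
  have hk : k < Fintype.card ι := (hL 0).2.trans_le (card_le_univ _)
  -- adjoin coercive functions below the level at the points of `Q`
  obtain ⟨M, hM⟩ := (Q.image fun x => ‖x‖ - L x + 1).exists_le
  replace hM : ∀ x ∈ Q, ‖x‖ - M < L x := fun x hx => by
    have := hM _ (mem_image_of_mem _ hx)
    linarith
  set a₁ : ι ⊕ (Fin (k + 1) × Fin d × Bool) → Fin d → ℝ :=
    Sum.elim a fun p => signedBasisVector p.2.1 p.2.2 with ha₁
  set b₁ : ι ⊕ (Fin (k + 1) × Fin d × Bool) → ℝ := Sum.elim b fun _ => -M with hb₁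
  have hcard : Fintype.card (ι ⊕ (Fin (k + 1) × Fin d × Bool))
      = Fintype.card ι + (k + 1) * (d * 2) := by simp
  have hk₁ : k < Fintype.card (ι ⊕ (Fin (k + 1) × Fin d × Bool)) := by omega
  choose L₁ hL₁ using fun x => exists_isKthLargest hk₁ fun i => a₁ i ⬝ᵥ x + b₁ i
  have hLL₁ : ∀ x, L x ≤ L₁ x := by
    intro x
    rw [(hL₁ x).le_iff]
    refine (hL x).2.trans_le (card_le_card_of_injOn Sum.inl (fun i hi => ?_)
      Sum.inl_injective.injOn)
    simpa [ha₁, hb₁] using hi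
  -- At a point `x` of `Q` the adjoined functions are at most `‖x‖ - M`, below the level, so they do
  -- not alter it. With `hLL₁`, the points of `Q` remain strict local minima of `L₁`.
  have hL₁L : ∀ x ∈ Q, L₁ x = L x := by
    intro x hx
    refine le_antisymm ?_ (hLL₁ x)
    by_contra hlt
    push Not at hlt
    have hsub : univ.filter (fun i => L₁ x ≤ a₁ i ⬝ᵥ x + b₁ i)
        ⊆ (univ.filter fun i => L x < a i ⬝ᵥ x + b i).image Sum.inl := by
      intro i hi
      have hi := hlt.trans_le (mem_filter.1 hi).2
      rcases i with i | ⟨q, j, s⟩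
      · exact mem_image_of_mem _ (mem_filter.2 ⟨mem_univ _, hi⟩)
      · exfalso
        simp only [ha₁, hb₁, Sum.elim_inr, signedBasisVector_dotProduct] at hi
        have h1 := hM x hx
        have h2 := abs_le.1 (norm_le_pi_norm x j)
        split_ifs at hi <;> linarith
    have := (hL₁ x).2.trans_le ((card_le_card hsub).trans card_image_le)
    exact absurd (hL x).1 (not_le.2 this)
  have hcont₁ : Continuous L₁ := continuous_of_isKthLargest (fun i => by fun_prop) hL₁
  -- isolate the minima by disjoint balls
  obtain ⟨r, hr, hrU, hrQ⟩ : ∃ r : ℝ, 0 < r ∧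
      (∀ x ∈ Q, ∀ y ∈ Metric.closedBall x r, y ≠ x → L₁ x < L₁ y) ∧
      ∀ x ∈ Q, ∀ y ∈ Q, x ≠ y → 2 * r < dist x y := by
    have h1 : ∀ᶠ r : ℝ in 𝓝[>] 0, ∀ x ∈ Q, ∀ y ∈ Metric.closedBall x r, y ≠ x → L₁ x < L₁ y := by
      rw [Filter.eventually_all_finset]
      intro x hx
      obtain ⟨U, hU, hxU, hmin⟩ := hQ x hx
      obtain ⟨ρ, hρ, hball⟩ := Metric.isOpen_iff.1 hU x hxU
      filter_upwards [Ioo_mem_nhdsGT hρ] with r hr y hy hne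
      rw [hL₁L x hx]
      exact (hmin y (hball (lt_of_le_of_lt hy hr.2)) hne).trans_le (hLL₁ y)
    have h2 : ∀ᶠ r : ℝ in 𝓝[>] 0, ∀ x ∈ Q, ∀ y ∈ Q, x ≠ y → 2 * r < dist x y := by
      rw [Filter.eventually_all_finset]
      intro x _
      rw [Filter.eventually_all_finset]
      intro y _
      by_cases hxy : x = y
      · simp [hxy]
      · filter_upwards [Ioo_mem_nhdsGT (half_pos (dist_pos.2 hxy))] with r hr _
        linarith [hr.2]
    have h3 : ∀ᶠ r : ℝ in 𝓝[>] 0, 0 < r := self_mem_nhdsWithin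
    obtain ⟨r, h1, h2, h3⟩ := (h1.and (h2.and h3)).exists
    exact ⟨r, h3, h1, h2⟩
  obtain ⟨δ, hδ, hsphere⟩ : ∃ δ : ℝ, 0 < δ ∧ ∀ x ∈ Q, ∀ y ∈ Metric.sphere x r,
      L₁ x + δ ≤ L₁ y := by
    have h1 : ∀ᶠ δ : ℝ in 𝓝[>] 0, ∀ x ∈ Q, ∀ y ∈ Metric.sphere x r, L₁ x + δ ≤ L₁ y := by
      rw [Filter.eventually_all_finset]
      intro x hx
      -- The sphere is empty when `d = 0`.
      rcases (Metric.sphere x r).eq_empty_or_nonempty with he | hne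
      · simp [he]
      · obtain ⟨z, hz, hmin⟩ := (isCompact_sphere x r).exists_isMinOn hne hcont₁.continuousOn
        have hlt := hrU x hx z (Metric.sphere_subset_closedBall hz)
          (Metric.ne_of_mem_sphere hz hr.ne')
        filter_upwards [Ioo_mem_nhdsGT (sub_pos.2 hlt)] with δ hδ y hy
        have : L₁ z ≤ L₁ y := hmin hy
        linarith [hδ.2]
    have h3 : ∀ᶠ r : ℝ in 𝓝[>] 0, 0 < r := self_mem_nhdsWithin
    obtain ⟨δ, h1, h3⟩ := (h1.and h3).exists
    exact ⟨δ, h3, h1⟩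
  obtain ⟨K, hK⟩ := (Q.image fun x => ‖x‖ + r).exists_le
  have hKball : ∀ x ∈ Q, ∀ y ∈ Metric.closedBall x r, ‖y‖ ≤ |K| := by
    intro x hx y hy
    have h1 := hK _ (mem_image_of_mem _ hx)
    have h2 : ‖y - x‖ ≤ r := by rw [← dist_eq_norm]; exact hy
    have h3 : ‖y‖ ≤ ‖x‖ + ‖y - x‖ := norm_le_norm_add_norm_sub' y x
    linarith [le_abs_self K]
  -- perturb to general position
  obtain ⟨ε, hε, hεd, hεδ⟩ : ∃ ε : ℝ, 0 < ε ∧ d * ε ≤ 1 / 2 ∧ d * ε * |K| + ε ≤ δ / 4 := by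
    have e1 : ∀ᶠ ε : ℝ in 𝓝[>] 0, d * ε < 1 / 2 := by
      have : Tendsto (fun ε : ℝ => d * ε) (𝓝[>] 0) (𝓝 (d * 0)) :=
        Continuous.tendsto (by fun_prop) 0 |>.mono_left nhdsWithin_le_nhds
      exact this.eventually_lt_const (by norm_num)
    have e2 : ∀ᶠ ε : ℝ in 𝓝[>] 0, d * ε * |K| + ε < δ / 4 := by
      have : Tendsto (fun ε : ℝ => d * ε * |K| + ε) (𝓝[>] 0) (𝓝 (d * 0 * |K| + 0)) :=
        Continuous.tendsto (f := fun ε : ℝ => d * ε * |K| + ε) (by fun_prop) 0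
          |>.mono_left nhdsWithin_le_nhds
      exact this.eventually_lt_const (by simpa using hδ)
    have e3 : ∀ᶠ r : ℝ in 𝓝[>] 0, 0 < r := self_mem_nhdsWithin
    obtain ⟨ε, h1, h2, h3⟩ := (e1.and (e2.and e3)).exists
    exact ⟨ε, h3, h1.le, h2.le⟩
  obtain ⟨a₂, b₂, hgp, ha₂, hb₂⟩ := exists_isGeneralPosition
    (show d ≤ Fintype.card (ι ⊕ (Fin (k + 1) × Fin d × Bool)) by rw [hcard]; nlinarith) a₁ b₁ hε
  choose L₂ hL₂ using fun x => exists_isKthLargest hk₁ fun i => a₂ i ⬝ᵥ x + b₂ i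
  have hcont₂ : Continuous L₂ := continuous_of_isKthLargest (fun i => by fun_prop) hL₂
  have hclose : ∀ x ∈ Q, ∀ y ∈ Metric.closedBall x r, L₁ y - δ / 4 ≤ L₂ y ∧
      L₂ y - δ / 4 ≤ L₁ y := by
    intro x hx y hy
    have hd : ∀ i, |(a₂ i ⬝ᵥ y + b₂ i) - (a₁ i ⬝ᵥ y + b₁ i)| ≤ δ / 4 := by
      intro i
      have h1 := abs_dotProduct_le_of_forall_abs_le (u := a₂ i - a₁ i) (y := y) (ha₂ i)
      have h2 : d * ε * ‖y‖ ≤ d * ε * |K| :=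
        mul_le_mul_of_nonneg_left (hKball x hx y hy) (by positivity)
      have h3 : (a₂ i ⬝ᵥ y + b₂ i) - (a₁ i ⬝ᵥ y + b₁ i) = (a₂ i - a₁ i) ⬝ᵥ y + (b₂ i - b₁ i) := by
        rw [sub_dotProduct]; ring
      rw [h3]
      exact (abs_add_le _ _).trans (by linarith [hb₂ i])
    exact ⟨(hL₁ y).sub_le (hL₂ y) fun i => by rw [abs_sub_comm]; exact hd i,
      (hL₂ y).sub_le (hL₁ y) hd⟩
  -- The perturbed level is higher on the sphere than at the center, so its minimum over the closed
  -- ball is interior. It may be non-strict, which suffices for the bound in general position.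
  have hZ : ∀ x : Fin d → ℝ, ∃ z : Fin d → ℝ, x ∈ Q → dist z x < r ∧ ∀ᶠ y in 𝓝 z, L₂ z ≤ L₂ y := by
    intro x
    by_cases hx : x ∈ Q
    · have hxx : x ∈ Metric.closedBall x r := Metric.mem_closedBall_self hr.le
      obtain ⟨z, hz, hmin⟩ := (isCompact_closedBall x r).exists_isMinOn ⟨x, hxx⟩
        hcont₂.continuousOn
      have hzr : dist z x < r := by
        refine lt_of_le_of_ne hz fun heq => ?_
        have h1 := hsphere x hx z heq
        have h2 := (hclose x hx z hz).1
        have h3 := (hclose x hx x hxx).2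
        have h4 : L₂ z ≤ L₂ x := hmin hxx
        linarith
      refine ⟨z, fun _ => ⟨hzr, ?_⟩⟩
      filter_upwards [Metric.isOpen_ball.mem_nhds (Metric.mem_ball.2 hzr)] with y hy
      exact hmin (Metric.ball_subset_closedBall hy)
    · exact ⟨0, fun h => absurd h hx⟩
  choose Z hZ using hZ
  have hinj : Set.InjOn Z Q := by
    intro x hx y hy hxy
    by_contra hne
    have h1 := hrQ x hx y hy hne
    have h2 := (hZ x hx).1
    have h3 := (hZ y hy).1
    rw [← hxy] at h3
    have := dist_triangle_left x y (Z x)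
    linarith
  rw [← card_image_of_injOn hinj]
  -- With this `m`, coercivity is required exactly of the subcollections missing at most `k`
  -- members; `C` absorbs the constant terms.
  refine card_local_min_le_of_isGeneralPosition hgp
    (m := Fintype.card (ι ⊕ (Fin (k + 1) × Fin d × Bool)) - k) (by omega) (c := 1 / 2)
    (C := ∑ i, |b₂ i|) (by norm_num) (fun R hR y => ?_) _ fun z hz => ?_
  · obtain ⟨i, hi, h⟩ := exists_mem_half_norm_le_dotProduct hk a₂ hεd
      (fun q j s l => ha₂ (Sum.inr (q, j, s)) l) (show _ ≤ R.card + k by omega) y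
    refine ⟨i, hi, ?_⟩
    have : |b₂ i| ≤ ∑ i, |b₂ i| :=
      single_le_sum (f := fun i => |b₂ i|) (fun _ _ => abs_nonneg _) (mem_univ i)
    linarith [neg_abs_le (b₂ i)]
  · obtain ⟨x, hx, rfl⟩ := mem_image.1 hz
    refine ⟨L₂ (Z x), (hL₂ (Z x)).1, ?_⟩
    filter_upwards [(hZ x hx).2] with y hy using ((hL₂ y).le_iff _).1 hy

theorem proposition4p3 {d : ℕ} (k : ℕ) {ι : Type*} [Fintype ι]
    (h : ι → (EuclideanSpace ℝ (Fin d) →ᵃ[ℝ] ℝ))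
    (L : EuclideanSpace ℝ (Fin d) → ℝ) (hL : IsLevel h k L) :
    {x | IsLevelLocalMin L x}.encard ≤ ((d + k).choose d : ℕ∞) := by
  classical
  by_contra hlt
  push Not at hlt
  -- The set of minima is not known to be finite, so a finite subset with one element too many is
  -- used.
  obtain ⟨t, htsub, ht⟩ := Set.exists_subset_encard_eq (Order.add_one_le_of_lt hlt)
  have htfin : t.Finite := Set.finite_of_encard_eq_coe (k := (d + k).choose d + 1) (by simpa using ht)
  lift t to Finset (EuclideanSpace ℝ (Fin d)) using htfin
  rw [Set.encard_coe_eq_coe_finsetCard] at ht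
  have hcard : t.card = (d + k).choose d + 1 := by exact_mod_cast ht
  have hform : ∀ i (x : Fin d → ℝ), h i (WithLp.toLp 2 x)
      = (fun j => (h i).linear (EuclideanSpace.single j 1)) ⬝ᵥ x + h i 0 := by
    intro i x
    have h1 : WithLp.toLp 2 x = ∑ j, x j • EuclideanSpace.single j (1 : ℝ) := by
      ext l
      simp [Pi.single_apply]
    have h2 := congrFun (AffineMap.decomp (h i)) (WithLp.toLp 2 x)
    rw [h2, Pi.add_apply, h1, map_sum]
    simp [dotProduct, mul_comm (x _)]
  -- Strict local minimality depends only on the topology, so the Euclidean norm may be exchanged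
  -- for the sup norm of `Fin d → ℝ`.
  have hle := card_strict_local_min_le (k := k)
    (fun i j => (h i).linear (EuclideanSpace.single j 1)) (fun i => h i 0)
    (fun x => L (WithLp.toLp 2 x))
    (fun x => funext (hform · x) ▸ hL.isKthLargest (WithLp.toLp 2 x))
    (t.image WithLp.ofLp) (fun x' hx' => by
      obtain ⟨x, hx, rfl⟩ := mem_image.1 hx'
      obtain ⟨U, hU, hxU, hmin⟩ := htsub (mem_coe.2 hx)
      refine ⟨WithLp.toLp 2 ⁻¹' U, hU.preimage (PiLp.continuous_toLp 2 _), hxU,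
        fun y hy hne => hmin _ hy fun he => hne ?_⟩
      rw [← he])
  rw [card_image_of_injective _ (WithLp.ofLp_injective 2), hcard] at hle
  omega
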